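/- Let $\Theta$ be a Borel subset of a complete separable metric space with its Borel $\sigma$-algebra, $\mu$ a $\sigma$-finite measure on $\Theta$, and $\mathbb G$ a stochastic kernel on $\Theta$ with a (jointly measurable) density, $\mathbb G(\ell,\Lambda)=\int_\Lambda g(\ell,t)\,\mu(dt)$, such that $\int_\Theta g(t,\ell)\,\mu(dt)>0$ for $\mu$-a.e. $\ell$. Consider Markov chains $\vartheta=(\vartheta(k))_{k\in\mathbb N}$ in $\Theta$, on probability spaces, with kernel $\mathbb G$ and with an initial distribution (the law of $\vartheta_0=\vartheta(0)$) that has a $\mu$-a.e. positive density with respect to $\mu$; "for any $\vartheta_0$" below means for all such chains. Let $\mathfrak F_k=\sigma(\vartheta(0),\dots,\vartheta(k))$, and let $l^2(\mathbb N;\mathbb R^r)$ be the space of sequences $v=(v(k))_{k\in\mathbb N}$ of $\mathbb R^r$-valued random variables with $v(k)$ $\mathfrak F_k$-measurable and $\|v\|_{l^2}^2=\sum_{k}\mathbf E\|v(k)\|^2<\infty$. Let $\mathcal H_\infty^{n\times m}$ be the space of measurable $M:\Theta\to\mathbb R^{n\times m}$ with $\|M\|_{\mathcal H_\infty^{n\times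 m}}=\operatorname{ess\,sup}_{\ell}\|M(\ell)\|<\infty$, where the essential supremum is with respect to $\mu$ and $\|M(\ell)\|$ is the spectral norm. For $A\in\mathcal H_\infty^{n\times n}$, $B\in\mathcal H_\infty^{n\times r}$, $C\in\mathcal H_\infty^{r\times n}$, $D\in\mathcal H_\infty^{r\times r}$ consider $$x(k+1)=A(\vartheta(k))x(k)+B(\vartheta(k))v(k),\qquad z(k)=C(\vartheta(k))x(k)+D(\vartheta(k))v(k),$$ and let $\mathfrak L(v)=z$ be the output for $x(0)=0$. The system $(A|\mathbb G)$: $x(k+1)=A(\vartheta(k))x(k)$ is exponentially mean-square stable (EMSS) if there are $\beta>0$ and $\alpha\in(0,1)$ with $\mathbf E\|x(k)\|^2\le\beta\alpha^k\|x_0\|^2$ for all $k\in\mathbb N$, all $x(0)=x_0\in\mathbb R^n$ and any $\vartheta_0$. The $H_\infty$ norm of $\mathfrak L$ is $$\|\mathfrak L\|_\infty=\inf\{\sqrt\gamma:\ \gamma>0,\ \|\mathfrak L(v)\|_{l^2}^2-\gamma\|v\|_{l^2}^2<0\text{ for any }\vartheta_0\text{ and any nonzero }v\in l^2(\mathbb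 N;\mathbb R^r)\}.$$ If $(A|\mathbb G)$ is EMSS and $C=0$, so that $\mathfrak L_{C=0}(v)(k)=D(\vartheta(k))v(k)$, then $$\|\mathfrak L_{C=0}\|_\infty=\|D\|_{\mathcal H_\infty^{r\times r}}.$$ -/

import Mathlib

open MeasureTheory ProbabilityTheory
open scoped ENNReal

noncomputable section

namespace MJLS

universe u

/-- `ℝⁿ` with its Euclidean norm. -/
abbrev Vec (n : ℕ) : Type := EuclideanSpace ℝ (Fin n)

/-- `ℝ^{n×m} = B(ℝᵐ, ℝⁿ)` with the induced (spectral) norm. -/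
abbrev Mat (n m : ℕ) : Type := Vec m →L[ℝ] Vec n

section Coefficients

variable {Θ : Type u} [MeasurableSpace Θ]

/-- The norm of `H_∞^{n×m}`: the `μ`-essential supremum of `ℓ ↦ ‖M ℓ‖`, as an extended
nonnegative number. -/
def hNorm (μ : Measure Θ) {n m : ℕ} (M : Θ → Mat n m) : ℝ≥0∞ :=
  essSup (fun ℓ => ‖M ℓ‖ₑ) μ

/-- Membership in `H_∞^{n×m}`: measurable and `μ`-essentially bounded. -/
structure MemH (μ : Measure Θ) {n m : ℕ} (M : Θ → Mat n m) : Prop where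
  measurable : Measurable M
  norm_lt_top : hNorm μ M < ∞

end Coefficients

section Chain

variable {Θ : Type u} [MeasurableSpace Θ] {Ω : Type u}

/-- The `σ`-field generated by `ϑ 0, …, ϑ k`. -/
abbrev history (ϑ : ℕ → Ω → Θ) (k : ℕ) : MeasurableSpace Ω :=
  ⨆ j ≤ k, MeasurableSpace.comap (ϑ j) inferInstance

/-- `ϑ` is a Markov chain on the probability space `(Ω, P)` with stochastic kernel `G`, whose
initial distribution has a `μ`-a.e. positive density with respect to `μ`. -/
structure IsChain [MeasurableSpace Ω] (μ : Measure Θ) (G : Kernel Θ Θ) (P : Measure Ω)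
    (ϑ : ℕ → Ω → Θ) : Prop where
  measurable : ∀ k, Measurable (ϑ k)
  markov : ∀ (k : ℕ) (Λ : Set Θ), MeasurableSet Λ →
    P[(ϑ (k + 1) ⁻¹' Λ).indicator (fun _ => (1 : ℝ)) | history ϑ k]
      =ᵐ[P] fun ω => (G (ϑ k ω)).real Λ
  initial : ∃ ν₀ : Θ → ℝ≥0∞, Measurable ν₀ ∧ P.map (ϑ 0) = μ.withDensity ν₀ ∧
    ∀ᵐ ℓ ∂μ, 0 < ν₀ ℓ

/-- The solution of `x(k+1) = A(ϑ(k)) x(k)`, `x(0) = x₀`. -/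
def freeState {n : ℕ} (A : Θ → Mat n n) (ϑ : ℕ → Ω → Θ) (x₀ : Vec n) : ℕ → Ω → Vec n
  | 0, _ => x₀
  | k + 1, ω => A (ϑ k ω) (freeState A ϑ x₀ k ω)

/-- The solution of `x(k+1) = A(ϑ(k)) x(k) + B(ϑ(k)) v(k)`, `x(0) = x₀`. -/
def state {n r : ℕ} (A : Θ → Mat n n) (B : Θ → Mat n r) (ϑ : ℕ → Ω → Θ) (x₀ : Vec n)
    (v : ℕ → Ω → Vec r) : ℕ → Ω → Vec n
  | 0, _ => x₀
  | k + 1, ω => A (ϑ k ω) (state A B ϑ x₀ v k ω) + B (ϑ k ω) (v k ω)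

/-- The output `z(k) = C(ϑ(k)) x(k) + D(ϑ(k)) v(k)` for the state started at `x(0) = x₀`. -/
def output {n r : ℕ} (A : Θ → Mat n n) (B : Θ → Mat n r) (C : Θ → Mat r n) (D : Θ → Mat r r)
    (ϑ : ℕ → Ω → Θ) (x₀ : Vec n) (v : ℕ → Ω → Vec r) (k : ℕ) (ω : Ω) : Vec r :=
  C (ϑ k ω) (state A B ϑ x₀ v k ω) + D (ϑ k ω) (v k ω)

/-- The input-to-output operator: the output for the zero initial state. -/
def ioOperator {n r : ℕ} (A : Θ → Mat n n) (B : Θ → Mat n r) (C : Θ → Mat r n)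
    (D : Θ → Mat r r) (ϑ : ℕ → Ω → Θ) (v : ℕ → Ω → Vec r) : ℕ → Ω → Vec r :=
  output A B C D ϑ 0 v

/-- The squared norm `∑ₖ E ‖v(k)‖²`. -/
def energy [MeasurableSpace Ω] (P : Measure Ω) {r : ℕ} (v : ℕ → Ω → Vec r) : ℝ≥0∞ :=
  ∑' k, ∫⁻ ω, ‖v k ω‖ₑ ^ 2 ∂P

/-- Membership in `l²(ℕ; ℝʳ)`: `v k` is measurable with respect to the history up to time `k`,
and the energy is finite. -/
structure MemL2 [MeasurableSpace Ω] (P : Measure Ω) (ϑ : ℕ → Ω → Θ) {r : ℕ}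
    (v : ℕ → Ω → Vec r) : Prop where
  adapted : ∀ k, Measurable[history ϑ k] (v k)
  energy_lt_top : energy P v < ∞

/-- The performance function `J_γ = ‖𝔏 v‖² - γ ‖v‖²` for the zero initial state; it is an
extended real, equal to `+∞` if `v` has finite and `𝔏 v` has infinite energy. -/
def performance [MeasurableSpace Ω] (P : Measure Ω) {n r : ℕ} (A : Θ → Mat n n)
    (B : Θ → Mat n r) (C : Θ → Mat r n) (D : Θ → Mat r r) (ϑ : ℕ → Ω → Θ) (γ : ℝ)
    (v : ℕ → Ω → Vec r) : EReal :=
  (energy P (ioOperator A B C D ϑ v) : EReal) - ((ENNReal.ofReal γ * energy P v : ℝ≥0∞) : EReal)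

end Chain

section Norms

variable {Θ : Type u} [MeasurableSpace Θ]

/-- `(A | G)` is exponentially mean-square stable: the constants are uniform over all initial
states `x₀` and all initial conditions `ϑ 0` (that is, over all chains with kernel `G`). -/
def IsEMSS (μ : Measure Θ) (G : Kernel Θ Θ) {n : ℕ} (A : Θ → Mat n n) : Prop :=
  ∃ β : ℝ, 0 < β ∧ ∃ α : ℝ, 0 < α ∧ α < 1 ∧
    ∀ (Ω : Type u) [MeasurableSpace Ω] (P : Measure Ω) [IsProbabilityMeasure P]
      (ϑ : ℕ → Ω → Θ), IsChain μ G P ϑ → ∀ (x₀ : Vec n) (k : ℕ),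
        ∫⁻ ω, ‖freeState A ϑ x₀ k ω‖ₑ ^ 2 ∂P ≤ ENNReal.ofReal (β * α ^ k * ‖x₀‖ ^ 2)

/-- The `H_∞` norm of the input-to-output operator: the infimum of the `√γ`, `γ > 0`, such that
`J_γ < 0` for all initial conditions `ϑ 0` and all nonzero inputs `v ∈ l²(ℕ; ℝʳ)`. The infimum
is taken in `[0, ∞]`, so it is `∞` if there is no such `γ`. -/
def hInfNorm (μ : Measure Θ) (G : Kernel Θ Θ) {n r : ℕ} (A : Θ → Mat n n) (B : Θ → Mat n r)
    (C : Θ → Mat r n) (D : Θ → Mat r r) : ℝ≥0∞ :=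
  sInf {c : ℝ≥0∞ | ∃ γ : ℝ, 0 < γ ∧ c = ENNReal.ofReal (Real.sqrt γ) ∧
    ∀ (Ω : Type u) [MeasurableSpace Ω] (P : Measure Ω) [IsProbabilityMeasure P]
      (ϑ : ℕ → Ω → Θ), IsChain μ G P ϑ → ∀ v : ℕ → Ω → Vec r, MemL2 P ϑ v →
        (¬ ∀ k, v k =ᵐ[P] 0) → performance P A B C D ϑ γ v < 0}

end Norms

end MJLS

end

/-!
With `C = 0` the state does not reach the output, so `𝔏` multiplies `v k` by `D (ϑ k)` pointwise.

The bound `‖𝔏‖ ≤ ‖D‖` holds because every transition law `G ℓ` has a density with respect to `μ`: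
together with the density of the initial law, this makes the law of each `ϑ k` absolutely continuous
with respect to `μ` (`IsChain.map_absolutelyContinuous`). Hence `‖D (ϑ k)‖ ≤ ‖D‖` almost surely, and
`‖𝔏 v‖² ≤ ‖D‖² ‖v‖²` (`IsChain.energy_feedthrough_le`); for `γ > ‖D‖²` the inequality
`‖𝔏 v‖² < γ ‖v‖²` follows, as `0 < ‖v‖ < ∞`.

For the reverse bound, let `γ < ‖D‖²`, so that `‖D ℓ‖ > √γ` on a set of positive `μ`-measure.
Searching the maximizing direction in a countable dense set gives a fixed vector `w` and a set `S` of
positive measure with `‖D ℓ w‖ > √γ ‖w‖` on `S` (`exists_vector_of_lt_hNorm`). The Ionescu-Tulcea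
theorem provides one admissible chain, with initial law equivalent to `μ` (`exists_isChain`), and the
input equal to `w` at time `0` on `{ϑ 0 ∈ S}` and zero otherwise makes the performance function
nonnegative.
-/

open MeasureTheory ProbabilityTheory Filter
open scoped ENNReal NNReal

noncomputable section

namespace MJLS

universe u

variable {Θ : Type u} [MeasurableSpace Θ] {μ : Measure Θ} {G : Kernel Θ Θ}

/-! ### Laws of an admissible chain -/

lemma history_le {Ω : Type u} [MeasurableSpace Ω] {ϑ : ℕ → Ω → Θ} (hϑ : ∀ k, Measurable (ϑ k))
    (k : ℕ) : history ϑ k ≤ ‹MeasurableSpace Ω› :=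
  iSup₂_le fun j _ => (hϑ j).comap_le

/-- Each transition erases the previous law and leaves an average of the measures `G ℓ ≪ μ`. -/
lemma IsChain.map_absolutelyContinuous (hG : ∀ ℓ, G ℓ ≪ μ) {Ω : Type u} [MeasurableSpace Ω]
    {P : Measure Ω} [IsProbabilityMeasure P] {ϑ : ℕ → Ω → Θ} (h : IsChain μ G P ϑ) (k : ℕ) :
    P.map (ϑ k) ≪ μ := by
  cases k with
  | zero =>
    obtain ⟨ν₀, -, hmap, -⟩ := h.initial
    rw [hmap]
    exact withDensity_absolutelyContinuous _ _
  | succ k =>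
    refine Measure.AbsolutelyContinuous.mk fun Λ hΛ hμΛ => ?_
    rw [Measure.map_apply (h.measurable _) hΛ]
    have hm : MeasurableSet (ϑ (k + 1) ⁻¹' Λ) := h.measurable _ hΛ
    have hint := integral_condExp (μ := P) (history_le h.measurable k)
      (f := (ϑ (k + 1) ⁻¹' Λ).indicator (fun _ => (1 : ℝ)))
    rw [integral_congr_ae (h.markov k Λ hΛ), integral_indicator_const _ hm] at hint
    have hzero : ∀ ω, (G (ϑ k ω)).real Λ = 0 := fun ω => by
      rw [measureReal_def, hG _ hμΛ, ENNReal.toReal_zero]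
    simp only [hzero, integral_zero, smul_eq_mul, mul_one] at hint
    exact (measureReal_eq_zero_iff).1 hint.symm

lemma IsChain.energy_feedthrough_le (hG : ∀ ℓ, G ℓ ≪ μ) {r : ℕ} {D : Θ → Mat r r}
    (hD : MemH μ D) {Ω : Type u} [MeasurableSpace Ω] {P : Measure Ω} [IsProbabilityMeasure P]
    {ϑ : ℕ → Ω → Θ} (h : IsChain μ G P ϑ) (v : ℕ → Ω → Vec r) :
    energy P (fun k ω => D (ϑ k ω) (v k ω)) ≤ hNorm μ D ^ 2 * energy P v := by
  rw [energy, energy, ← ENNReal.tsum_mul_left]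
  refine ENNReal.tsum_le_tsum fun k => ?_
  rw [← lintegral_const_mul' _ _ (ENNReal.pow_ne_top hD.norm_lt_top.ne)]
  refine lintegral_mono_ae ?_
  have hess : ∀ᵐ ℓ ∂μ, ‖D ℓ‖ₑ ≤ hNorm μ D := ae_le_essSup
  filter_upwards [ae_of_ae_map (h.measurable k).aemeasurable
    ((h.map_absolutelyContinuous hG k).ae_le hess)] with ω hω
  rw [← mul_pow]
  gcongr
  exact ((D (ϑ k ω)).le_opENorm _).trans (by gcongr)

lemma MemL2.energy_ne_zero {Ω : Type u} [MeasurableSpace Ω] {P : Measure Ω} {ϑ : ℕ → Ω → Θ}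
    (hϑ : ∀ k, Measurable (ϑ k)) {r : ℕ} {v : ℕ → Ω → Vec r} (hv : MemL2 P ϑ v)
    (hne : ¬ ∀ k, v k =ᵐ[P] 0) : energy P v ≠ 0 := by
  contrapose! hne
  intro k
  have hk : Measurable (v k) := (hv.adapted k).mono (history_le hϑ k) le_rfl
  have h0 := ENNReal.tsum_eq_zero.1 hne k
  rw [lintegral_eq_zero_iff (hk.enorm.pow_const 2)] at h0
  filter_upwards [h0] with ω hω
  simpa using hω

/-! ### Existence of an admissible chain -/

lemma history_eval (k : ℕ) :
    history (fun (j : ℕ) (x : ℕ → Θ) => x j) k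
      = MeasurableSpace.pi.comap (Preorder.frestrictLe (π := fun _ : ℕ => Θ) k) := by
  simp only [history, MeasurableSpace.pi, MeasurableSpace.comap_iSup, MeasurableSpace.comap_comp,
    iSup_subtype, Finset.mem_Iic]
  rfl

/-- The transition kernel of the chain with kernel `G`, as a kernel on the whole past. -/
def pastKernel (G : Kernel Θ Θ) (k : ℕ) : Kernel (Finset.Iic k → Θ) Θ :=
  G.comap (fun x => x ⟨k, Finset.mem_Iic.2 le_rfl⟩) (measurable_pi_apply _)

instance [IsMarkovKernel G] (k : ℕ) : IsMarkovKernel (pastKernel G k) := by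
  unfold pastKernel
  infer_instance

lemma map_eval_zero_trajMeasure (μ₀ : Measure Θ) [IsProbabilityMeasure μ₀] [IsMarkovKernel G] :
    (Kernel.trajMeasure (X := fun _ : ℕ => Θ) μ₀ (pastKernel G)).map (fun x => x 0) = μ₀ := by
  have hcomp : (fun x : ℕ → Θ => x 0)
      = (fun y : Finset.Iic 0 → Θ => y ⟨0, Finset.mem_Iic.2 le_rfl⟩)
        ∘ Preorder.frestrictLe (π := fun _ : ℕ => Θ) 0 := rfl
  rw [hcomp, ← Measure.map_map (measurable_pi_apply _) (by fun_prop), Kernel.trajMeasure,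
    Measure.map_comp _ _ (by fun_prop), Kernel.traj_map_frestrictLe, Kernel.partialTraj_self,
    Measure.id_comp, Measure.map_map (measurable_pi_apply _) (by fun_prop)]
  exact Measure.map_id

lemma isChain_trajMeasure [StandardBorelSpace Θ] [IsMarkovKernel G] {μ₀ : Measure Θ}
    [IsProbabilityMeasure μ₀] (h₀ : ∃ ν₀ : Θ → ℝ≥0∞, Measurable ν₀ ∧ μ₀ = μ.withDensity ν₀ ∧
      ∀ᵐ ℓ ∂μ, 0 < ν₀ ℓ) :
    IsChain μ G (Kernel.trajMeasure (X := fun _ : ℕ => Θ) μ₀ (pastKernel G)) (fun j x => x j) where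
  measurable k := measurable_pi_apply k
  markov k Λ hΛ := by
    have : Nonempty Θ := nonempty_of_isProbabilityMeasure μ₀
    rw [history_eval]
    have hX : Measurable (Preorder.frestrictLe (π := fun _ : ℕ => Θ) k) := by fun_prop
    refine (condDistrib_ae_eq_condExp hX (measurable_pi_apply (k + 1)) hΛ).symm.trans ?_
    filter_upwards [ae_of_ae_map hX.aemeasurable (Kernel.condDistrib_trajMeasure
      (X := fun _ : ℕ => Θ) (μ₀ := μ₀) (κ := pastKernel G) (a := k))] with x hx
    rw [hx]
    rfl
  initial := by rwa [map_eval_zero_trajMeasure]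

/-- A nonzero `σ`-finite measure is equivalent to a probability measure, which serves as the
initial law. -/
lemma exists_isChain [StandardBorelSpace Θ] (μ : Measure Θ) [SigmaFinite μ] [NeZero μ]
    (G : Kernel Θ Θ) [IsMarkovKernel G] :
    ∃ P : Measure (ℕ → Θ), IsProbabilityMeasure P ∧ IsChain μ G P (fun j x => x j) :=
  ⟨Kernel.trajMeasure (X := fun _ : ℕ => Θ) μ.toFinite (pastKernel G), inferInstance,
    isChain_trajMeasure ⟨μ.toFinite.rnDeriv μ, Measure.measurable_rnDeriv _ _,
      (Measure.withDensity_rnDeriv_eq _ _ (toFinite_absolutelyContinuous μ)).symm,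
      Measure.rnDeriv_pos' (absolutelyContinuous_toFinite μ)⟩⟩

lemma IsChain.absolutelyContinuous_map_zero {Ω : Type u} [MeasurableSpace Ω] {P : Measure Ω}
    {ϑ : ℕ → Ω → Θ} (h : IsChain μ G P ϑ) : μ ≪ P.map (ϑ 0) := by
  obtain ⟨ν₀, hν₀, hmap, hpos⟩ := h.initial
  rw [hmap]
  exact withDensity_absolutelyContinuous' hν₀.aemeasurable (hpos.mono fun _ => ne_of_gt)

/-! ### Inputs that nearly attain the norm -/

/-- An operator norm larger than `c` is witnessed on a countable dense set of vectors, so a single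
vector works on a set of positive measure. -/
lemma exists_vector_of_lt_hNorm {n m : ℕ} {M : Θ → Mat n m} (hM : Measurable M) {c : ℝ≥0}
    (hc : (c : ℝ≥0∞) < hNorm μ M) :
    ∃ w : Vec m, MeasurableSet {ℓ | c * ‖w‖ₑ < ‖M ℓ w‖ₑ} ∧ μ {ℓ | c * ‖w‖ₑ < ‖M ℓ w‖ₑ} ≠ 0 := by
  have hmeas : ∀ w : Vec m, MeasurableSet {ℓ | c * ‖w‖ₑ < ‖M ℓ w‖ₑ} := fun w =>
    measurableSet_lt measurable_const (hM.apply_continuousLinearMap w).enorm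
  by_contra! hcon
  refine hc.not_ge (essSup_le_of_ae_le _ ?_)
  have hall : ∀ᵐ ℓ ∂μ, ∀ i, ‖M ℓ (TopologicalSpace.denseSeq (Vec m) i)‖ₑ
      ≤ c * ‖TopologicalSpace.denseSeq (Vec m) i‖ₑ :=
    ae_all_iff.2 fun i => by
      have h0 := hcon _ (hmeas (TopologicalSpace.denseSeq (Vec m) i))
      rw [measure_eq_zero_iff_ae_notMem] at h0
      exact h0.mono fun ℓ hℓ => not_lt.1 hℓ
  filter_upwards [hall] with ℓ hℓ
  have hbound : ∀ w, ‖M ℓ w‖₊ ≤ c * ‖w‖₊ := by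
    intro w
    refine (TopologicalSpace.denseRange_denseSeq (Vec m)).induction_on
      (p := fun w => ‖M ℓ w‖₊ ≤ c * ‖w‖₊) w ?_ fun i => ?_
    · exact isClosed_le (by fun_prop) (by fun_prop)
    · have h := hℓ i
      simp only [enorm_eq_nnnorm] at h
      exact_mod_cast h
  rw [enorm_eq_nnnorm]
  exact_mod_cast ContinuousLinearMap.opNNNorm_le_bound (M ℓ) c hbound

/-! ### The two bounds for a vanishing output matrix `C` -/

omit [MeasurableSpace Θ] in
lemma performance_zero_neg_iff {Ω : Type u} [MeasurableSpace Ω] {P : Measure Ω} {n r : ℕ}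
    {A : Θ → Mat n n} {B : Θ → Mat n r} {D : Θ → Mat r r} {ϑ : ℕ → Ω → Θ} {γ : ℝ}
    {v : ℕ → Ω → Vec r} (hv : energy P v ≠ ∞) :
    performance P A B (fun _ => (0 : Mat r n)) D ϑ γ v < 0 ↔
      energy P (fun k ω => D (ϑ k ω) (v k ω)) < ENNReal.ofReal γ * energy P v := by
  have hio : ioOperator A B (fun _ => (0 : Mat r n)) D ϑ v = fun k ω => D (ϑ k ω) (v k ω) := by
    funext k ω
    simp [ioOperator, output]
  have hfin : ENNReal.ofReal γ * energy P v ≠ ∞ := ENNReal.mul_ne_top ENNReal.ofReal_ne_top hv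
  rw [performance, hio, EReal.sub_neg (.inr (EReal.coe_ennreal_eq_top_iff.not.2 hfin))
    (.inr (EReal.coe_ennreal_ne_bot _))]
  exact EReal.coe_ennreal_lt_coe_ennreal_iff

/-- The upper bound, through the levels `γ = (‖D‖ + ε)²`. -/
lemma hInfNorm_zero_le (hG : ∀ ℓ, G ℓ ≪ μ) {n r : ℕ} (A : Θ → Mat n n) (B : Θ → Mat n r)
    {D : Θ → Mat r r} (hD : MemH μ D) :
    hInfNorm μ G A B (fun _ => (0 : Mat r n)) D ≤ hNorm μ D := by
  refine ENNReal.le_of_forall_pos_le_add fun ε hε _ => sInf_le ?_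
  lift hNorm μ D to ℝ≥0 using hD.norm_lt_top.ne with d hd
  refine ⟨((d + ε : ℝ≥0) : ℝ) ^ 2, by positivity, ?_, ?_⟩
  · rw [Real.sqrt_sq (NNReal.coe_nonneg _), ENNReal.ofReal_coe_nnreal, ENNReal.coe_add]
  · intro Ω _ P _ ϑ hϑ v hv hne
    rw [performance_zero_neg_iff hv.energy_lt_top.ne, ENNReal.ofReal_pow (NNReal.coe_nonneg _),
      ENNReal.ofReal_coe_nnreal]
    refine (hϑ.energy_feedthrough_le hG hD v).trans_lt ?_
    rw [← hd]
    refine (ENNReal.mul_lt_mul_iff_left (hv.energy_ne_zero hϑ.measurable hne)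
      hv.energy_lt_top.ne).2 ?_
    norm_cast
    exact pow_lt_pow_left₀ (lt_add_of_pos_right d hε) zero_le two_ne_zero

/-- The input equal to `w` at time `0` when `ϑ 0` lies in `S`, and zero otherwise. -/
def impulse {Ω : Type u} {r : ℕ} (ϑ : ℕ → Ω → Θ) (S : Set Θ) (w : Vec r) (k : ℕ) (ω : Ω) : Vec r :=
  if k = 0 then S.indicator (fun _ => w) (ϑ 0 ω) else 0

omit [MeasurableSpace Θ] in
lemma energy_feedthrough_impulse {Ω : Type u} [MeasurableSpace Ω] (P : Measure Ω) {r : ℕ}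
    (D : Θ → Mat r r) (ϑ : ℕ → Ω → Θ) (S : Set Θ) (w : Vec r) :
    energy P (fun k ω => D (ϑ k ω) (impulse ϑ S w k ω))
      = ∫⁻ ω, (ϑ 0 ⁻¹' S).indicator (fun ω => ‖D (ϑ 0 ω) w‖ₑ ^ 2) ω ∂P := by
  rw [energy, tsum_eq_single 0 fun k hk => by simp [impulse, hk]]
  refine lintegral_congr fun ω => ?_
  by_cases hω : ϑ 0 ω ∈ S <;> simp [impulse, hω]

lemma energy_impulse {Ω : Type u} [MeasurableSpace Ω] (P : Measure Ω) {r : ℕ}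
    {ϑ : ℕ → Ω → Θ} (hϑ : Measurable (ϑ 0)) {S : Set Θ} (hS : MeasurableSet S) (w : Vec r) :
    energy P (impulse ϑ S w) = ‖w‖ₑ ^ 2 * P (ϑ 0 ⁻¹' S) := by
  have h := energy_feedthrough_impulse P (fun _ => ContinuousLinearMap.id ℝ (Vec r)) ϑ S w
  simp only [ContinuousLinearMap.id_apply] at h
  exact h.trans (lintegral_indicator_const (hϑ hS) _)

lemma measurable_impulse {Ω : Type u} {r : ℕ} (ϑ : ℕ → Ω → Θ) {S : Set Θ} (hS : MeasurableSet S)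
    (w : Vec r) (k : ℕ) : Measurable[history ϑ k] (impulse ϑ S w k) := by
  rcases eq_or_ne k 0 with rfl | hk
  · have h0 : Measurable[history ϑ 0] (ϑ 0) :=
      Measurable.of_comap_le (le_iSup₂_of_le 0 le_rfl le_rfl)
    exact (measurable_const.indicator hS).comp h0
  · have : impulse ϑ S w k = fun _ => 0 := by
      funext ω
      simp [impulse, hk]
    rw [this]
    exact measurable_const

/-- The lower bound: the impulse along a nearly maximizing vector has nonnegative performance at every
level `γ < ‖D‖²`. -/
lemma le_hInfNorm_zero [StandardBorelSpace Θ] [SigmaFinite μ] [IsMarkovKernel G] {n r : ℕ}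
    (A : Θ → Mat n n) (B : Θ → Mat n r) {D : Θ → Mat r r} (hD : Measurable D) :
    hNorm μ D ≤ hInfNorm μ G A B (fun _ => (0 : Mat r n)) D := by
  refine le_sInf ?_
  rintro _ ⟨γ, hγ, rfl, hperf⟩
  by_contra! hlt
  obtain ⟨w, hS, hμS⟩ := exists_vector_of_lt_hNorm hD (c := (√γ).toNNReal) hlt
  set S := {ℓ | ((√γ).toNNReal : ℝ≥0∞) * ‖w‖ₑ < ‖D ℓ w‖ₑ} with hSdef
  have : NeZero μ := ⟨fun h => hμS (by simp [h])⟩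
  obtain ⟨P, hP, hϑ⟩ := exists_isChain μ G
  set ϑ : ℕ → (ℕ → Θ) → Θ := fun j x => x j
  have hw : w ≠ 0 := by
    rintro rfl
    simp [hSdef] at hμS
  have hPS : P (ϑ 0 ⁻¹' S) ≠ 0 := by
    rw [← Measure.map_apply (hϑ.measurable 0) hS]
    exact fun h => hμS (hϑ.absolutelyContinuous_map_zero h)
  have hen := energy_impulse P (hϑ.measurable 0) hS w
  have hfin : energy P (impulse ϑ S w) < ∞ := by
    rw [hen]
    exact ENNReal.mul_lt_top (ENNReal.pow_lt_top enorm_lt_top) (measure_lt_top _ _)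
  have hne : ¬ ∀ k, impulse ϑ S w k =ᵐ[P] 0 := fun h => by
    have h0 : energy P (impulse ϑ S w) = 0 := ENNReal.tsum_eq_zero.2 fun k => by
      rw [lintegral_congr_ae ((h k).mono fun ω hω => by simp [hω] :
        (fun ω => ‖impulse ϑ S w k ω‖ₑ ^ 2) =ᵐ[P] fun _ => 0), lintegral_zero]
    rw [hen] at h0
    simp [hw, hPS] at h0
  have hneg := hperf _ P ϑ hϑ _ ⟨measurable_impulse ϑ hS w, hfin⟩ hne
  rw [performance_zero_neg_iff hfin.ne] at hneg
  refine hneg.not_ge ?_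
  have hsq : ENNReal.ofReal γ = ((√γ).toNNReal : ℝ≥0∞) ^ 2 := by
    rw [← ENNReal.ofReal, ← ENNReal.ofReal_pow (Real.sqrt_nonneg γ), Real.sq_sqrt hγ.le]
  rw [energy_feedthrough_impulse, hen, ← mul_assoc, hsq, ← mul_pow,
    ← lintegral_indicator_const (hϑ.measurable 0 hS)]
  refine lintegral_mono fun ω => Set.indicator_le_indicator' fun hω => ?_
  have hlt' : _ < ‖D (ϑ 0 ω) w‖ₑ := hω
  gcongr

end MJLS

theorem proposition3 {Θ : Type*} [MeasurableSpace Θ] [StandardBorelSpace Θ]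
    (μ : Measure Θ) [SigmaFinite μ]
    (G : Kernel Θ Θ) [IsMarkovKernel G]
    (g : Θ → Θ → ℝ≥0∞) (hg : Measurable (Function.uncurry g))
    (hG : ∀ ℓ, G ℓ = μ.withDensity (g ℓ))
    (hpos : ∀ᵐ ℓ ∂μ, 0 < ∫⁻ t, g t ℓ ∂μ)
    (n r : ℕ) (A : Θ → MJLS.Mat n n) (B : Θ → MJLS.Mat n r) (D : Θ → MJLS.Mat r r)
    (hA : MJLS.MemH μ A) (hB : MJLS.MemH μ B) (hD : MJLS.MemH μ D)
    (hstable : MJLS.IsEMSS μ G A) :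
    MJLS.hInfNorm μ G A B (fun _ => (0 : MJLS.Mat r n)) D = MJLS.hNorm μ D :=
  le_antisymm
    (MJLS.hInfNorm_zero_le (fun ℓ => hG ℓ ▸ withDensity_absolutelyContinuous _ _) A B hD)
    (MJLS.le_hInfNorm_zero A B hD.measurable)

end
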